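/- Let $A$ and $B$ be finite-dimensional quantum systems, $d_A=\dim A$, let $\log$ denote the logarithm in base $2$, and let $\rho_{AB}$ be a density operator on $A\otimes B$ (positive semidefinite, $\mathrm{tr}\,\rho_{AB}=1$) with reduced operators $\rho_A=\mathrm{tr}_B\,\rho_{AB}$ and $\rho_B=\mathrm{tr}_A\,\rho_{AB}$. For positive semidefinite operators $\rho\neq 0$ and $\sigma$ put $$D(\rho\|\sigma)=\begin{cases}\frac{1}{\mathrm{tr}\,\rho}\,\mathrm{tr}\left[\rho(\log\rho-\log\sigma)\right] & \text{if } \mathrm{supp}(\rho)\subseteq\mathrm{supp}(\sigma),\\ \infty & \text{otherwise,}\end{cases}$$ where logarithms of operators are taken on their supports, and, if $D(\rho\|\sigma)<\infty$, $$V(\rho\|\sigma)=\frac{1}{\mathrm{tr}\,\rho}\,\mathrm{tr}\left[\rho\left(\log\rho-\log\sigma-D(\rho\|\sigma)\,\mathrm{id}\right)^2\right].$$ Then $D(\rho_{AB}\|\mathrm{id}_A\otimes\rho_B)$ and $D(\rho_{AB}\|\rho_A\otimes\rho_B)$ are finite, so that the conditional entropy variance $V(A|B)_\rho=V(\rho_{AB}\|\mathrm{id}_A\otimes\rho_B)$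 and the mutual information variance $V(A;B)_\rho=V(\rho_{AB}\|\rho_A\otimes\rho_B)$ are well defined, and they satisfy $$V(A|B)_\rho\le\log^2(2d_A^2+1),\qquad V(A;B)_\rho\le 4\log^2(2d_A+1).$$ Moreover, if $A$ is classical, that is, if $\rho_{AB}=\sum_a p(a)\,|a\rangle\langle a|\otimes\rho_B(a)$ for some orthonormal basis $(|a\rangle)_a$ of $A$, some probability distribution $p$ and some density operators $\rho_B(a)$ on $B$, then $$V(A|B)_\rho\le\log^2(2d_A+1),\qquad V(A;B)_\rho\le 4\log^2(2\sqrt{d_A}+1).$$ -/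

import Mathlib

open scoped Kronecker ComplexOrder

noncomputable section

namespace QInfo

variable {ι α β : Type*} [Fintype ι] [DecidableEq ι] [Fintype α] [DecidableEq α]
  [Fintype β] [DecidableEq β]

/-- A normalized density operator on the finite-dimensional Hilbert space `ℂ^ι`: a positive
semidefinite matrix of trace one. -/
def IsDensityOperator (ρ : Matrix ι ι ℂ) : Prop :=
  ρ.PosSemidef ∧ ρ.trace = 1

/-- The reduced operator `ρ_A = tr_B ρ_AB` (partial trace over the second factor). -/
def marginalA (ρ : Matrix (α × β) (α × β) ℂ) : Matrix α α ℂ :=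
  Matrix.of fun i j => ∑ k, ρ (i, k) (j, k)

/-- The reduced operator `ρ_B = tr_A ρ_AB` (partial trace over the first factor). -/
def marginalB (ρ : Matrix (α × β) (α × β) ℂ) : Matrix β β ℂ :=
  Matrix.of fun k l => ∑ i, ρ (i, k) (i, l)

/-- The base-two logarithm of a positive semidefinite matrix, by functional calculus. Eigenvectors
of eigenvalue zero are sent to zero, i.e. the logarithm is taken on the support. -/
def mlog (ρ : Matrix ι ι ℂ) : Matrix ι ι ℂ :=
  cfc (Real.logb 2) ρ

/-- The inclusion `supp ρ ⊆ supp σ`; the support of a Hermitian matrix is its range. -/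
def SuppLE (ρ σ : Matrix ι ι ℂ) : Prop :=
  LinearMap.range ρ.mulVecLin ≤ LinearMap.range σ.mulVecLin

open Classical in
/-- The relative entropy `D(ρ‖σ) = tr[ρ (log ρ - log σ)] / tr ρ` of positive semidefinite matrices
when `supp ρ ⊆ supp σ`, and `∞` otherwise. -/
def relEntropy (ρ σ : Matrix ι ι ℂ) : EReal :=
  if SuppLE ρ σ then
    (((1 / ρ.trace.re) * (ρ * (mlog ρ - mlog σ)).trace.re : ℝ) : EReal)
  else ⊤

/-- The divergence variance
`V(ρ‖σ) = tr[ρ (log ρ - log σ - D(ρ‖σ) id)²] / tr ρ` of positive semidefinite matrices;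
it is meaningful when `D(ρ‖σ)` is finite. -/
def divVariance (ρ σ : Matrix ι ι ℂ) : ℝ :=
  (1 / ρ.trace.re) *
    (ρ * (mlog ρ - mlog σ - ((relEntropy ρ σ).toReal : ℂ) • (1 : Matrix ι ι ℂ)) ^ 2).trace.re

/-- The conditional entropy variance `V(A|B)_ρ = V(ρ_AB ‖ id_A ⊗ ρ_B)`. -/
def condVariance (ρ : Matrix (α × β) (α × β) ℂ) : ℝ :=
  divVariance ρ ((1 : Matrix α α ℂ) ⊗ₖ marginalB ρ)

/-- The mutual information variance `V(A;B)_ρ = V(ρ_AB ‖ ρ_A ⊗ ρ_B)`. -/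
def mutualVariance (ρ : Matrix (α × β) (α × β) ℂ) : ℝ :=
  divVariance ρ (marginalA ρ ⊗ₖ marginalB ρ)

/-- The system `A` is classical: for some orthonormal basis `(|x⟩)` of `A`, probability
distribution `p` and density operators `ρ_B(x)`, one has `ρ_AB = ∑ x, p x • |x⟩⟨x| ⊗ ρ_B(x)`. -/
def IsClassicalOnA (ρ : Matrix (α × β) (α × β) ℂ) : Prop :=
  ∃ (e : OrthonormalBasis α ℂ (EuclideanSpace ℂ α)) (p : α → ℝ) (τ : α → Matrix β β ℂ),
    (∀ x, 0 ≤ p x) ∧ ∑ x, p x = 1 ∧ (∀ x, IsDensityOperator (τ x)) ∧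
      ρ = ∑ x, (p x : ℂ) •
        (Matrix.vecMulVec (fun i => e x i) (fun i => star (e x i)) ⊗ₖ τ x)

end QInfo

end

namespace QInfo

open Matrix

set_option linter.unusedSectionVars false

/-! ### A second-moment bound for the logarithm of a positive random variable. -/

section Scalar

/-! In eigenbases `u`, `w` of `ρ` and `σ`, with eigenvalues `p` and `m`, the weights `p i * |⟨u i, w
j⟩|²` form a probability distribution. Under it `V(ρ‖σ)` is the variance of `log r` with `r = p i /
m j`, hence at most `E[log² r]`. Since `r + 1/r + 1` dominates `r` and `1/r` and is at least `3 >
e`, and `log²` is concave on `[e, ∞)`, Jensen bounds this by `log² (E[r] + E[1/r] + 1)`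
(`sum_mul_logb_sq_le`).

Always `E[1/r] ≤ tr σ`, and `E[r] = tr (ρ² σ⁻¹) ≤ K` once `ρ ≤ K σ`
(`sum_overlapWeight_mul_div_le`). For `σ = id ⊗ ρ_B` the trace is `d_A`, while `K = d_A` always
works and `K = 1` works for classical `A`.

For `σ = ρ_A ⊗ ρ_B` the scalar bound is applied to `√r`, whence the factor 4: Cauchy-Schwarz gives
`E[√r] ≤ √(E[1/a] E[p/b]) ≤ √(d_A K)`, where `a`, `b` are the eigenvalues of the marginals, and
`E[1/√r] ≤ 1`. -/

theorem concaveOn_log_sq : ConcaveOn ℝ (Set.Ici (Real.exp 1)) fun x : ℝ => Real.log x ^ 2 := by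
  have hpos : ∀ x ∈ Set.Ici (Real.exp 1), x ≠ 0 := fun x hx =>
    ((Real.exp_pos 1).trans_le hx).ne'
  have hd : ∀ x ∈ Set.Ici (Real.exp 1),
      HasDerivAt (fun x : ℝ => Real.log x ^ 2) (2 * (Real.log x / x)) x := fun x hx => by
    refine ((Real.hasDerivAt_log (hpos x hx)).pow 2).congr_deriv ?_
    rw [Nat.add_one_sub_one, pow_one]
    push_cast
    ring
  refine AntitoneOn.concaveOn_of_deriv (convex_Ici _)
    (fun x hx => (hd x hx).continuousAt.continuousWithinAt)
    (fun x hx => (hd x (interior_subset hx)).differentiableAt.differentiableWithinAt) ?_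
  intro x hx y hy hxy
  rw [(hd x (interior_subset hx)).deriv, (hd y (interior_subset hy)).deriv]
  exact mul_le_mul_of_nonneg_left
    (Real.log_div_self_antitoneOn (interior_subset hx) (interior_subset hy) hxy) zero_le_two

theorem log_sq_le_log_add_inv_sq {r : ℝ} (hr : 0 < r) :
    Real.log r ^ 2 ≤ Real.log (r + r⁻¹ + 1) ^ 2 := by
  have hi : 0 < r⁻¹ := inv_pos.2 hr
  have h0 : 0 ≤ Real.log (r + r⁻¹ + 1) := Real.log_nonneg (by linarith)
  refine sq_le_sq' ?_ (Real.log_le_log hr (by linarith))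
  have := Real.log_le_log hi (show r⁻¹ ≤ r + r⁻¹ + 1 by linarith)
  rw [Real.log_inv] at this
  linarith

/-- The summand 1 is what lifts the argument above `e`: `r + r⁻¹` can be as small as 2, outside the
range of concavity. -/
theorem three_le_add_inv_add_one {r : ℝ} (hr : 0 < r) : 3 ≤ r + r⁻¹ + 1 := by
  have h : r * r⁻¹ = 1 := mul_inv_cancel₀ hr.ne'
  nlinarith [sq_nonneg (r - r⁻¹), inv_pos.2 hr]

/-- If `r` is a positive random variable with `E[r] ≤ a` and `E[r⁻¹] ≤ b`, then
`E[log² r] ≤ log² (a + b + 1)`. -/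
theorem sum_mul_logb_sq_le {κ : Type*} [Fintype κ] {P r : κ → ℝ} {a b : ℝ}
    (hP : ∀ k, 0 ≤ P k) (hsum : ∑ k, P k = 1) (hr : ∀ k, P k ≠ 0 → 0 < r k)
    (ha : ∑ k, P k * r k ≤ a) (hb : ∑ k, P k * (r k)⁻¹ ≤ b) :
    ∑ k, P k * Real.logb 2 (r k) ^ 2 ≤ Real.logb 2 (a + b + 1) ^ 2 := by
  classical
  -- Points of weight zero may have `r k ≤ 0`; the value 1 there changes no sum and keeps every
  -- point in the domain of Jensen's inequality.
  set r' : κ → ℝ := fun k => if P k = 0 then 1 else r k with hr'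
  have hr'pos : ∀ k, 0 < r' k := fun k => by
    by_cases h : P k = 0
    · simp [hr', h]
    · simpa [hr', h] using hr k h
  have hcongr : ∀ (F : ℝ → ℝ), ∑ k, P k * F (r k) = ∑ k, P k * F (r' k) := fun F =>
    Finset.sum_congr rfl fun k _ => by
      by_cases h : P k = 0 <;> simp [hr', h]
  have hmem : ∀ k, r' k + (r' k)⁻¹ + 1 ∈ Set.Ici (Real.exp 1) := fun k =>
    Real.exp_one_lt_three.le.trans (three_le_add_inv_add_one (hr'pos k))
  have hJ := concaveOn_log_sq.le_map_sum (t := Finset.univ) (w := P) (fun k _ => hP k) hsum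
    (fun k _ => hmem k)
  have hE3 : 3 ≤ ∑ k, P k • (r' k + (r' k)⁻¹ + 1) := by
    calc (3 : ℝ) = ∑ k, P k * 3 := by rw [← Finset.sum_mul, hsum, one_mul]
      _ ≤ _ := Finset.sum_le_sum fun k _ =>
        mul_le_mul_of_nonneg_left (three_le_add_inv_add_one (hr'pos k)) (hP k)
  have hE : ∑ k, P k • (r' k + (r' k)⁻¹ + 1) ≤ a + b + 1 := by
    rw [hcongr fun x => x] at ha
    rw [hcongr fun x => x⁻¹] at hb
    simp only [smul_eq_mul, mul_add, Finset.sum_add_distrib, mul_one, hsum]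
    linarith
  have hlog : ∑ k, P k * Real.log (r k) ^ 2 ≤ Real.log (a + b + 1) ^ 2 := by
    rw [hcongr fun x => Real.log x ^ 2]
    calc ∑ k, P k * Real.log (r' k) ^ 2
        ≤ ∑ k, P k • Real.log (r' k + (r' k)⁻¹ + 1) ^ 2 := Finset.sum_le_sum fun k _ =>
          mul_le_mul_of_nonneg_left (log_sq_le_log_add_inv_sq (hr'pos k)) (hP k)
      _ ≤ _ := hJ
      _ ≤ _ := pow_le_pow_left₀ (Real.log_nonneg (by linarith))
          (Real.log_le_log (by linarith) hE) 2
  simp only [Real.logb, div_pow, mul_div_assoc']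
  rw [← Finset.sum_div]
  gcongr

end Scalar

/-! ### Functional calculus and traces through the overlap of two eigenbases. -/

section Diagonalization

variable {n : Type*} [Fintype n] [DecidableEq n]

/-- The diagonal matrix with real entries `d`. -/
abbrev rdiag (d : n → ℝ) : Matrix n n ℂ := diagonal fun i => (d i : ℂ)

/-- `ρ` is diagonalized by the unitary `U`, with eigenvalues `d`. -/
structure Diagonalizes (ρ U : Matrix n n ℂ) (d : n → ℝ) : Prop where
  left : Uᴴ * U = 1
  right : U * Uᴴ = 1
  eq : ρ = U * rdiag d * Uᴴ

theorem exists_diagonalizes {ρ : Matrix n n ℂ} (hρ : ρ.PosSemidef) :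
    ∃ U d, Diagonalizes ρ U d ∧ ∀ i, 0 ≤ d i := by
  refine ⟨hρ.1.eigenvectorUnitary, hρ.1.eigenvalues, ⟨?_, ?_, ?_⟩, hρ.eigenvalues_nonneg⟩
  · exact Unitary.coe_star_mul_self _
  · exact Unitary.coe_mul_star_self _
  · conv_lhs => rw [hρ.1.spectral_theorem]
    rfl

/-- The functional calculus can be computed in every diagonalization. -/
theorem Diagonalizes.cfc {ρ U : Matrix n n ℂ} {d : n → ℝ} (h : Diagonalizes ρ U d)
    (hρ : ρ.IsHermitian) (f : ℝ → ℝ) : cfc f ρ = U * rdiag (fun i => f (d i)) * Uᴴ := by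
  set W : Matrix n n ℂ := (hρ.eigenvectorUnitary : Matrix n n ℂ)
  set e := hρ.eigenvalues
  have hW1 : Wᴴ * W = 1 := Unitary.coe_star_mul_self _
  have hW2 : W * Wᴴ = 1 := Unitary.coe_mul_star_self _
  have hspec : ρ = W * rdiag e * Wᴴ := by
    conv_lhs => rw [hρ.spectral_theorem]
    rfl
  have hcfc : _root_.cfc f ρ = W * rdiag (fun i => f (e i)) * Wᴴ := by
    rw [hρ.cfc_eq]; rfl
  -- The overlap `Wᴴ * U` intertwines the two diagonal forms, so its entry `i j` vanishes unless `e
  -- i = d j`. It therefore intertwines their images under `f` as well.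
  have hT : rdiag e * (Wᴴ * U) = Wᴴ * U * rdiag d := by
    calc rdiag e * (Wᴴ * U) = (Wᴴ * W) * rdiag e * (Wᴴ * U) := by rw [hW1, one_mul]
      _ = Wᴴ * (W * rdiag e * Wᴴ) * U := by simp only [mul_assoc]
      _ = Wᴴ * U * rdiag d * (Uᴴ * U) := by rw [← hspec, h.eq]; simp only [mul_assoc]
      _ = _ := by rw [h.left, mul_one]
  have hT' : rdiag (fun i => f (e i)) * (Wᴴ * U) = Wᴴ * U * rdiag (fun i => f (d i)) := by
    ext i j
    have := congrFun (congrFun hT i) j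
    simp only [rdiag, diagonal_mul, mul_diagonal] at this ⊢
    rcases eq_or_ne ((Wᴴ * U) i j) 0 with h0 | h0
    · simp [h0]
    · rw [mul_comm] at this
      have : e i = d j := by exact_mod_cast mul_left_cancel₀ h0 this
      rw [this, mul_comm]
  calc _root_.cfc f ρ = W * (rdiag (fun i => f (e i)) * (Wᴴ * U)) * Uᴴ := by
        rw [hcfc]; simp only [mul_assoc, h.right, mul_one]
    _ = (W * Wᴴ) * U * rdiag (fun i => f (d i)) * Uᴴ := by rw [hT']; simp only [mul_assoc]
    _ = _ := by rw [hW2, one_mul]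

theorem Diagonalizes.trace_re {ρ U : Matrix n n ℂ} {d : n → ℝ} (h : Diagonalizes ρ U d) :
    ρ.trace.re = ∑ i, d i := by
  rw [h.eq, trace_mul_comm, ← mul_assoc, h.left, one_mul, trace_diagonal]
  simp

theorem Diagonalizes.conj_eq {ρ U : Matrix n n ℂ} {d : n → ℝ} (h : Diagonalizes ρ U d) :
    Uᴴ * ρ * U = rdiag d := by
  rw [h.eq]
  calc Uᴴ * (U * rdiag d * Uᴴ) * U = (Uᴴ * U) * rdiag d * (Uᴴ * U) := by simp only [mul_assoc]
    _ = _ := by rw [h.left, one_mul, mul_one]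

theorem sum_normSq_row {T : Matrix n n ℂ} (h : T * Tᴴ = 1) (i : n) :
    ∑ j, Complex.normSq (T i j) = 1 := by
  have := congrFun (congrFun h i) i
  simp only [mul_apply, conjTranspose_apply, one_apply_eq, RCLike.star_def,
    Complex.mul_conj] at this
  exact_mod_cast this

theorem sum_normSq_col {T : Matrix n n ℂ} (h : Tᴴ * T = 1) (j : n) :
    ∑ i, Complex.normSq (T i j) = 1 := by
  have := congrFun (congrFun h j) j
  simp only [mul_apply, conjTranspose_apply, one_apply_eq, RCLike.star_def, mul_comm,
    Complex.mul_conj] at this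
  exact_mod_cast this

/-- The matrix `L T - T M`, with `L`, `M` diagonal, entrywise. -/
theorem rdiag_mul_sub_mul_rdiag_apply (l m : n → ℝ) (T : Matrix n n ℂ) (i j : n) :
    (rdiag l * T - T * rdiag m) i j = ((l i - m j : ℝ) : ℂ) * T i j := by
  simp [rdiag, diagonal_mul, mul_diagonal]; ring

theorem overlap_mul_conjTranspose {U W : Matrix n n ℂ} (hU : Uᴴ * U = 1) (hW : W * Wᴴ = 1) :
    Uᴴ * W * (Uᴴ * W)ᴴ = 1 := by
  rw [conjTranspose_mul, conjTranspose_conjTranspose]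
  calc Uᴴ * W * (Wᴴ * U) = Uᴴ * (W * Wᴴ) * U := by simp only [mul_assoc]
    _ = 1 := by rw [hW, mul_one, hU]

theorem conjTranspose_mul_overlap {U W : Matrix n n ℂ} (hU : U * Uᴴ = 1) (hW : Wᴴ * W = 1) :
    (Uᴴ * W)ᴴ * (Uᴴ * W) = 1 := by
  rw [conjTranspose_mul, conjTranspose_conjTranspose]
  calc Wᴴ * U * (Uᴴ * W) = Wᴴ * (U * Uᴴ) * W := by simp only [mul_assoc]
    _ = 1 := by rw [hU, mul_one, hW]

theorem trace_mul_sub_re {U W : Matrix n n ℂ} (hU : Uᴴ * U = 1) (hW : W * Wᴴ = 1)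
    (p l m : n → ℝ) :
    (U * rdiag p * Uᴴ * (U * rdiag l * Uᴴ - W * rdiag m * Wᴴ)).trace.re =
      ∑ i, ∑ j, p i * Complex.normSq ((Uᴴ * W) i j) * (l i - m j) := by
  set T := Uᴴ * W with hT
  have hTT : T * Tᴴ = 1 := overlap_mul_conjTranspose hU hW
  have key : (U * rdiag p * Uᴴ * (U * rdiag l * Uᴴ - W * rdiag m * Wᴴ)).trace =
      (rdiag p * ((rdiag l * T - T * rdiag m) * Tᴴ)).trace := by
    rw [mul_assoc U, mul_assoc U, trace_mul_comm]
    congr 1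
    rw [sub_mul, mul_assoc (rdiag l), hTT, mul_one, hT, conjTranspose_mul,
      conjTranspose_conjTranspose]
    calc rdiag p * Uᴴ * (U * rdiag l * Uᴴ - W * rdiag m * Wᴴ) * U
        = rdiag p * ((Uᴴ * U) * rdiag l * (Uᴴ * U) - Uᴴ * W * rdiag m * (Wᴴ * U)) := by
          simp only [mul_sub, sub_mul, mul_assoc]
      _ = _ := by rw [hU, one_mul, mul_one]
  rw [key]
  simp only [trace, diag_apply, rdiag, diagonal_mul, Complex.re_sum]
  refine Finset.sum_congr rfl fun i _ => ?_
  rw [mul_apply, Finset.mul_sum, Complex.re_sum]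
  refine Finset.sum_congr rfl fun j _ => ?_
  rw [rdiag_mul_sub_mul_rdiag_apply, conjTranspose_apply, RCLike.star_def, mul_assoc,
    Complex.mul_conj, ← Complex.ofReal_mul, ← Complex.ofReal_mul, Complex.ofReal_re]
  ring

/-- The Hermitian difference equals both `U X Wᴴ` and `W Xᴴ Uᴴ`, so its square is `U X Xᴴ Uᴴ`, and
the entries of `X` are `(l i - m j) T i j`. -/
theorem trace_mul_sub_sq_re {U W : Matrix n n ℂ} (hU : Uᴴ * U = 1) (hU' : U * Uᴴ = 1)
    (hW' : Wᴴ * W = 1) (hW : W * Wᴴ = 1) (p l m : n → ℝ) :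
    (U * rdiag p * Uᴴ * (U * rdiag l * Uᴴ - W * rdiag m * Wᴴ) ^ 2).trace.re =
      ∑ i, ∑ j, p i * Complex.normSq ((Uᴴ * W) i j) * (l i - m j) ^ 2 := by
  set T := Uᴴ * W with hT
  set X := rdiag l * T - T * rdiag m with hX
  have hD : ∀ d : n → ℝ, (rdiag d)ᴴ = rdiag d := fun d => by
    rw [rdiag, diagonal_conjTranspose]
    congr 1; ext i; simp
  have hA : U * rdiag l * Uᴴ - W * rdiag m * Wᴴ = U * X * Wᴴ := by
    rw [hX, hT]
    calc _ = U * rdiag l * Uᴴ * (W * Wᴴ) - (U * Uᴴ) * W * rdiag m * Wᴴ := by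
          rw [hW, mul_one, hU', one_mul]
      _ = _ := by simp only [mul_sub, sub_mul, mul_assoc]
  have hA' : U * rdiag l * Uᴴ - W * rdiag m * Wᴴ = W * Xᴴ * Uᴴ := by
    have : (U * rdiag l * Uᴴ - W * rdiag m * Wᴴ)ᴴ = U * rdiag l * Uᴴ - W * rdiag m * Wᴴ := by
      simp only [conjTranspose_sub, conjTranspose_mul, conjTranspose_conjTranspose, hD, mul_assoc]
    rw [← this, hA]
    simp only [conjTranspose_mul, conjTranspose_conjTranspose, mul_assoc]
  have key : (U * rdiag p * Uᴴ * (U * rdiag l * Uᴴ - W * rdiag m * Wᴴ) ^ 2).trace =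
      (rdiag p * (X * Xᴴ)).trace := by
    rw [sq]
    nth_rw 1 [hA]
    rw [hA', mul_assoc U, mul_assoc U, trace_mul_comm]
    congr 1
    calc rdiag p * Uᴴ * (U * X * Wᴴ * (W * Xᴴ * Uᴴ)) * U
        = rdiag p * ((Uᴴ * U) * X * (Wᴴ * W) * Xᴴ * (Uᴴ * U)) := by simp only [mul_assoc]
      _ = _ := by rw [hU, hW', one_mul, mul_one, mul_one]
  rw [key]
  simp only [trace, diag_apply, rdiag, diagonal_mul, Complex.re_sum]
  refine Finset.sum_congr rfl fun i _ => ?_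
  rw [mul_apply, Finset.mul_sum, Complex.re_sum]
  refine Finset.sum_congr rfl fun j _ => ?_
  rw [conjTranspose_apply, RCLike.star_def, Complex.mul_conj, hX, rdiag_mul_sub_mul_rdiag_apply,
    Complex.normSq_mul, Complex.normSq_ofReal, ← Complex.ofReal_mul, Complex.ofReal_re]
  ring

end Diagonalization

/-! ### Partial traces and operator inequalities between `ρ_AB` and `id ⊗ ρ_B`. -/

section Marginals

variable {α β : Type*} [Fintype α] [DecidableEq α] [Fintype β] [DecidableEq β]

theorem Diagonalizes.kronecker {X U : Matrix α α ℂ} {Y V : Matrix β β ℂ} {a : α → ℝ} {b : β → ℝ}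
    (hX : Diagonalizes X U a) (hY : Diagonalizes Y V b) :
    Diagonalizes (X ⊗ₖ Y) (U ⊗ₖ V) (fun j => a j.1 * b j.2) where
  left := by rw [conjTranspose_kronecker, ← mul_kronecker_mul, hX.left, hY.left, one_kronecker_one]
  right := by
    rw [conjTranspose_kronecker, ← mul_kronecker_mul, hX.right, hY.right, one_kronecker_one]
  eq := by
    have : rdiag (fun j : α × β => a j.1 * b j.2) = rdiag a ⊗ₖ rdiag b := by
      rw [rdiag, rdiag, rdiag, diagonal_kronecker_diagonal]
      simp
    rw [this, conjTranspose_kronecker, ← mul_kronecker_mul, ← mul_kronecker_mul, ← hX.eq, ← hY.eq]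

/-- This lets `id ⊗ ρ_B` and `ρ_A ⊗ ρ_B` share one eigenbasis, so that the same weights serve both
variances. -/
theorem Diagonalizes.one_of_unitary {X U : Matrix α α ℂ} {a : α → ℝ} (hX : Diagonalizes X U a) :
    Diagonalizes (1 : Matrix α α ℂ) U (fun _ => 1) where
  left := hX.left
  right := hX.right
  eq := by simp [rdiag, hX.right]

theorem marginalB_kronecker_one_mul (X : Matrix α α ℂ) (M : Matrix (α × β) (α × β) ℂ) :
    marginalB ((X ⊗ₖ (1 : Matrix β β ℂ)) * M) = marginalB (M * (X ⊗ₖ (1 : Matrix β β ℂ))) := by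
  ext k l
  simp only [marginalB, of_apply, mul_apply, kroneckerMap_apply, one_apply, Fintype.sum_prod_type,
    mul_ite, ite_mul, mul_one, mul_zero, zero_mul, Finset.sum_ite_eq, Finset.sum_ite_eq',
    Finset.mem_univ, if_true]
  rw [Finset.sum_comm]
  exact Finset.sum_congr rfl fun _ _ => Finset.sum_congr rfl fun _ _ => mul_comm _ _

theorem marginalA_one_kronecker_mul (Y : Matrix β β ℂ) (M : Matrix (α × β) (α × β) ℂ) :
    marginalA (((1 : Matrix α α ℂ) ⊗ₖ Y) * M) = marginalA (M * ((1 : Matrix α α ℂ) ⊗ₖ Y)) := by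
  ext k l
  simp only [marginalA, of_apply, mul_apply, kroneckerMap_apply, one_apply,
    Fintype.sum_prod_type_right,
    mul_ite, ite_mul, one_mul, mul_zero, zero_mul, Finset.sum_ite_eq, Finset.sum_ite_eq',
    Finset.mem_univ, if_true]
  rw [Finset.sum_comm]
  exact Finset.sum_congr rfl fun _ _ => Finset.sum_congr rfl fun _ _ => mul_comm _ _

theorem marginalB_one_kronecker_mul_mul (Y Z : Matrix β β ℂ) (M : Matrix (α × β) (α × β) ℂ) :
    marginalB (((1 : Matrix α α ℂ) ⊗ₖ Y) * M * ((1 : Matrix α α ℂ) ⊗ₖ Z)) =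
      Y * marginalB M * Z := by
  ext k l
  simp only [marginalB, of_apply, mul_apply, kroneckerMap_apply, one_apply,
    Fintype.sum_prod_type_right,
    mul_ite, ite_mul, one_mul, mul_zero, zero_mul, Finset.sum_ite_eq, Finset.sum_ite_eq',
    Finset.mem_univ, if_true]
  rw [Finset.sum_comm]
  refine Finset.sum_congr rfl fun _ _ => ?_
  rw [← Finset.sum_mul, Finset.sum_comm]
  simp only [Finset.mul_sum]

theorem marginalA_kronecker_one_mul_mul (Y Z : Matrix α α ℂ) (M : Matrix (α × β) (α × β) ℂ) :
    marginalA ((Y ⊗ₖ (1 : Matrix β β ℂ)) * M * (Z ⊗ₖ (1 : Matrix β β ℂ))) =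
      Y * marginalA M * Z := by
  ext k l
  simp only [marginalA, of_apply, mul_apply, kroneckerMap_apply, one_apply,
    Fintype.sum_prod_type,
    mul_ite, ite_mul, mul_one, mul_zero, zero_mul, Finset.sum_ite_eq, Finset.sum_ite_eq',
    Finset.mem_univ, if_true]
  rw [Finset.sum_comm]
  refine Finset.sum_congr rfl fun _ _ => ?_
  rw [← Finset.sum_mul, Finset.sum_comm]
  simp only [Finset.mul_sum]

/-- Partial cyclicity cancels the unitary on the traced-out factor. -/
theorem marginalB_conj {U : Matrix α α ℂ} (hU : U * Uᴴ = 1) (V : Matrix β β ℂ)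
    (M : Matrix (α × β) (α × β) ℂ) :
    marginalB ((U ⊗ₖ V)ᴴ * M * (U ⊗ₖ V)) = Vᴴ * marginalB M * V := by
  have h1 : (U ⊗ₖ V)ᴴ = (Uᴴ ⊗ₖ (1 : Matrix β β ℂ)) * ((1 : Matrix α α ℂ) ⊗ₖ Vᴴ) := by
    rw [conjTranspose_kronecker, ← mul_kronecker_mul, mul_one, one_mul]
  have h2 : U ⊗ₖ V = ((1 : Matrix α α ℂ) ⊗ₖ V) * (U ⊗ₖ (1 : Matrix β β ℂ)) := by
    rw [← mul_kronecker_mul, mul_one, one_mul]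
  rw [h1, mul_assoc, mul_assoc, marginalB_kronecker_one_mul, h2,
    ← marginalB_one_kronecker_mul_mul]
  congr 1
  simp only [mul_assoc]
  rw [← mul_kronecker_mul U, hU, mul_one, one_kronecker_one, mul_one]

theorem marginalA_conj (U : Matrix α α ℂ) {V : Matrix β β ℂ} (hV : V * Vᴴ = 1)
    (M : Matrix (α × β) (α × β) ℂ) :
    marginalA ((U ⊗ₖ V)ᴴ * M * (U ⊗ₖ V)) = Uᴴ * marginalA M * U := by
  have h1 : (U ⊗ₖ V)ᴴ = ((1 : Matrix α α ℂ) ⊗ₖ Vᴴ) * (Uᴴ ⊗ₖ (1 : Matrix β β ℂ)) := by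
    rw [conjTranspose_kronecker, ← mul_kronecker_mul, mul_one, one_mul]
  have h2 : U ⊗ₖ V = (U ⊗ₖ (1 : Matrix β β ℂ)) * ((1 : Matrix α α ℂ) ⊗ₖ V) := by
    rw [← mul_kronecker_mul, mul_one, one_mul]
  rw [h1, mul_assoc, mul_assoc, marginalA_one_kronecker_mul, h2,
    ← marginalA_kronecker_one_mul_mul]
  congr 1
  simp only [mul_assoc]
  rw [← mul_kronecker_mul 1, hV, mul_one, one_kronecker_one, mul_one]

theorem trace_marginalA (ρ : Matrix (α × β) (α × β) ℂ) : (marginalA ρ).trace = ρ.trace := by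
  simp [marginalA, trace, Fintype.sum_prod_type]

theorem trace_marginalB (ρ : Matrix (α × β) (α × β) ℂ) : (marginalB ρ).trace = ρ.trace := by
  simp [marginalB, trace, Fintype.sum_prod_type_right]

theorem posSemidef_marginalA {ρ : Matrix (α × β) (α × β) ℂ} (hρ : ρ.PosSemidef) :
    (marginalA ρ).PosSemidef := by
  have : marginalA ρ = ∑ k, ρ.submatrix (fun i => (i, k)) (fun i => (i, k)) := by
    ext i j; simp [marginalA, Matrix.sum_apply]
  rw [this]
  exact posSemidef_sum _ fun k _ => hρ.submatrix _

theorem posSemidef_marginalB {ρ : Matrix (α × β) (α × β) ℂ} (hρ : ρ.PosSemidef) :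
    (marginalB ρ).PosSemidef := by
  have : marginalB ρ = ∑ k, ρ.submatrix (fun i => (k, i)) (fun i => (k, i)) := by
    ext i j; simp [marginalB, Matrix.sum_apply]
  rw [this]
  exact posSemidef_sum _ fun k _ => hρ.submatrix _

/-- The Cauchy-Schwarz inequality `v v* ≤ (v* v) • 1`. -/
theorem posSemidef_smul_one_sub_vecMulVec {v : α → ℂ} {c : ℝ} (hc : 0 < c)
    (hv : star v ⬝ᵥ v = (c : ℂ)) :
    ((c : ℂ) • (1 : Matrix α α ℂ) - vecMulVec v (star v)).PosSemidef := by
  set M := (c : ℂ) • (1 : Matrix α α ℂ) - vecMulVec v (star v) with hM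
  have hH : Mᴴ = M := by
    simp [hM, conjTranspose_sub, conjTranspose_smul, conjTranspose_vecMulVec]
  -- `M` is `c` times a projection, because `(v v*)² = c v v*`.
  have hsq : Mᴴ * M = (c : ℂ) • M := by
    rw [hH]
    nth_rw 1 [hM]
    rw [sub_mul, smul_mul_assoc, one_mul, sub_eq_self, hM, mul_sub, vecMulVec_mul_vecMulVec, hv,
      mul_smul_comm, mul_one, sub_eq_zero]
    ext i j
    simp [vecMulVec_apply]
    ring
  have hc' : (c : ℂ) ≠ 0 := by exact_mod_cast hc.ne'
  have : M = ((c⁻¹ : ℝ) : ℂ) • (Mᴴ * M) := by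
    rw [hsq, smul_smul, Complex.ofReal_inv, inv_mul_cancel₀ hc', one_smul]
  rw [this]
  refine (posSemidef_conjTranspose_mul_self M).smul ?_
  exact_mod_cast (inv_pos.2 hc).le

/-- A positive semidefinite operator satisfies `ρ_AB ≤ d_A • id_A ⊗ ρ_B`. -/
theorem posSemidef_card_smul_one_kronecker_sub [Nonempty α] {ρ : Matrix (α × β) (α × β) ℂ}
    (hρ : ρ.PosSemidef) :
    (((Fintype.card α : ℝ) : ℂ) • ((1 : Matrix α α ℂ) ⊗ₖ marginalB ρ) - ρ).PosSemidef := by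
  set d : ℂ := ((Fintype.card α : ℝ) : ℂ) with hd
  have hd0 : (0 : ℝ) < Fintype.card α := by exact_mod_cast Fintype.card_pos
  set C : Matrix α α ℂ := d • (1 : Matrix α α ℂ) - vecMulVec (fun _ => 1) (star fun _ => 1)
  set J : Matrix β β ℂ := vecMulVec (fun _ => 1) (star fun _ => 1)
  have hC : C.PosSemidef := posSemidef_smul_one_sub_vecMulVec hd0 (by simp [dotProduct])
  have hJ : J.PosSemidef := posSemidef_vecMulVec_self_star _
  have hdiag : ∀ a : α, (diagonal fun i => if i = a then (0 : ℂ) else 1).PosSemidef := fun a =>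
    .diagonal fun i => by by_cases h : i = a <;> simp [h]
  -- On diagonal blocks the right side is `(d - 1) ρ_ii + d ∑_{a ≠ i} ρ_aa`, off the diagonal
  -- `-ρ_ij`. The first term is positive by the Schur product theorem.
  have key : d • ((1 : Matrix α α ℂ) ⊗ₖ marginalB ρ) - ρ = hadamard ρ (C ⊗ₖ J) +
      d • ∑ a, (diagonal fun i => if i = a then (0 : ℂ) else 1) ⊗ₖ
        ρ.submatrix (fun k => (a, k)) (fun k => (a, k)) := by
    ext ⟨i, k⟩ ⟨j, l⟩
    simp only [Matrix.sub_apply, Matrix.add_apply, Matrix.smul_apply, hadamard_apply, kroneckerMap_apply,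
      Matrix.sum_apply, marginalB, of_apply, submatrix_apply, C, J, vecMulVec_apply, one_apply,
      diagonal_apply, Pi.star_apply, star_one, smul_eq_mul, mul_one]
    by_cases hij : i = j
    · subst hij
      simp only [if_true, ite_mul, zero_mul, one_mul, mul_one]
      have : ∑ a, (if i = a then 0 else ρ (a, k) (a, l)) =
          ∑ a, ρ (a, k) (a, l) - ρ (i, k) (i, l) := by
        have hite : ∀ a, (if i = a then 0 else ρ (a, k) (a, l)) =
            ρ (a, k) (a, l) - if i = a then ρ (a, k) (a, l) else 0 := fun a => by
          split_ifs <;> simp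
        rw [Finset.sum_congr rfl fun a _ => hite a, Finset.sum_sub_distrib, Finset.sum_ite_eq,
          if_pos (Finset.mem_univ _)]
      rw [this]
      ring
    · simp [hij]
  rw [key]
  refine (hρ.hadamard (hC.kronecker hJ)).add (PosSemidef.smul ?_ ?_)
  · exact posSemidef_sum _ fun a _ => (hdiag a).kronecker (hρ.submatrix _)
  · rw [hd]
    exact_mod_cast hd0.le

/-- If `A` is classical then `ρ_AB ≤ id_A ⊗ ρ_B`. -/
theorem IsClassicalOnA.posSemidef_one_kronecker_sub {ρ : Matrix (α × β) (α × β) ℂ}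
    (h : IsClassicalOnA ρ) :
    ((1 : Matrix α α ℂ) ⊗ₖ marginalB ρ - ρ).PosSemidef := by
  obtain ⟨e, p, τ, hp, -, hτ, rfl⟩ := h
  have hnorm : ∀ x, star (e x : α → ℂ) ⬝ᵥ (e x : α → ℂ) = ((1 : ℝ) : ℂ) := fun x => by
    have h1 := e.orthonormal.1 x
    have h2 := EuclideanSpace.inner_eq_star_dotProduct (e x) (e x)
    rw [inner_self_eq_norm_sq_to_K, h1] at h2
    rw [dotProduct_comm]
    simpa using h2.symm
  set E : α → Matrix α α ℂ := fun x => vecMulVec (fun i => e x i) (fun i => star (e x i)) with hE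
  have htr : ∀ x, ∑ i, E x i i = 1 := fun x => by
    simpa [hE, vecMulVec_apply, dotProduct, mul_comm] using hnorm x
  have hB : marginalB (∑ x, (p x : ℂ) • (E x ⊗ₖ τ x)) = ∑ x, (p x : ℂ) • τ x := by
    ext k l
    simp only [marginalB, of_apply, Matrix.sum_apply, Matrix.smul_apply, kroneckerMap_apply, smul_eq_mul]
    rw [Finset.sum_comm]
    refine Finset.sum_congr rfl fun x _ => ?_
    rw [← Finset.mul_sum, ← Finset.sum_mul, htr, one_mul]
  have key : (1 : Matrix α α ℂ) ⊗ₖ marginalB (∑ x, (p x : ℂ) • (E x ⊗ₖ τ x)) -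
      ∑ x, (p x : ℂ) • (E x ⊗ₖ τ x) = ∑ x, (p x : ℂ) • ((1 - E x) ⊗ₖ τ x) := by
    rw [hB]
    ext ⟨i, k⟩ ⟨j, l⟩
    simp only [Matrix.sub_apply, Matrix.sum_apply, Matrix.smul_apply, kroneckerMap_apply, smul_eq_mul,
      Finset.mul_sum, ← Finset.sum_sub_distrib]
    exact Finset.sum_congr rfl fun x _ => by ring
  rw [key]
  refine posSemidef_sum _ fun x _ => PosSemidef.smul (PosSemidef.kronecker ?_ (hτ x).1) ?_
  · have := posSemidef_smul_one_sub_vecMulVec one_pos (hnorm x)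
    rwa [Complex.ofReal_one, one_smul] at this
  · exact_mod_cast hp x

end Marginals

/-! ### The variance and the likelihood ratio of the Nussbaum-Szkoła distributions. -/

section Variance

variable {n : Type*} [Fintype n] [DecidableEq n] {ρ σ U W : Matrix n n ℂ} {p m : n → ℝ}

/-- The first of the two Nussbaum-Szkoła distributions of a pair of operators, where `p` are the
eigenvalues of the first operator and `T` is the overlap matrix of the eigenbases. -/
def overlapWeight (p : n → ℝ) (T : Matrix n n ℂ) (k : n × n) : ℝ :=
  p k.1 * Complex.normSq (T k.1 k.2)

theorem overlapWeight_nonneg (hp : ∀ i, 0 ≤ p i) (T : Matrix n n ℂ) (k : n × n) :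
    0 ≤ overlapWeight p T k :=
  mul_nonneg (hp _) (Complex.normSq_nonneg _)

theorem sum_overlapWeight {T : Matrix n n ℂ} (hT : T * Tᴴ = 1) :
    ∑ k, overlapWeight p T k = ∑ i, p i := by
  simp only [Fintype.sum_prod_type, overlapWeight, ← Finset.mul_sum, sum_normSq_row hT, mul_one]

/-- The divergence variance is at most the second moment of the log-likelihood ratio of the
Nussbaum-Szkoła distributions. -/
theorem divVariance_le (hρ : IsDensityOperator ρ) (hσ : σ.IsHermitian)
    (hU : Diagonalizes ρ U p) (hW : Diagonalizes σ W m) (hs : SuppLE ρ σ) :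
    divVariance ρ σ ≤ ∑ k, overlapWeight p (Uᴴ * W) k *
      (Real.logb 2 (p k.1) - Real.logb 2 (m k.2)) ^ 2 := by
  set T := Uᴴ * W
  set D : ℝ := (relEntropy ρ σ).toReal with hD
  have hlρ : mlog ρ = U * rdiag (fun i => Real.logb 2 (p i)) * Uᴴ := hU.cfc hρ.1.1 _
  have hlσ : mlog σ = W * rdiag (fun i => Real.logb 2 (m i)) * Wᴴ := hW.cfc hσ _
  have hD' : D = ∑ k, overlapWeight p T k * (Real.logb 2 (p k.1) - Real.logb 2 (m k.2)) := by
    rw [hD, relEntropy, if_pos hs, EReal.toReal_coe, hρ.2, Complex.one_re, div_one, one_mul, hlρ,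
      hlσ]
    nth_rw 1 [hU.eq]
    rw [trace_mul_sub_re hU.left hW.right, Fintype.sum_prod_type]
    rfl
  have hsum : ∑ k, overlapWeight p T k = 1 := by
    rw [sum_overlapWeight (overlap_mul_conjTranspose hU.left hW.right), ← hU.trace_re, hρ.2,
      Complex.one_re]
  have hshift : mlog ρ - mlog σ - (D : ℂ) • (1 : Matrix n n ℂ) =
      U * rdiag (fun i => Real.logb 2 (p i) - D) * Uᴴ -
        W * rdiag (fun i => Real.logb 2 (m i)) * Wᴴ := by
    have : rdiag (fun i => Real.logb 2 (p i) - D) =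
        rdiag (fun i => Real.logb 2 (p i)) - (D : ℂ) • (1 : Matrix n n ℂ) := by
      ext i j
      by_cases h : i = j <;> simp [h, rdiag]
    rw [this, hlρ, hlσ, mul_sub, sub_mul, mul_smul_comm, mul_one, smul_mul_assoc, hU.right,
      sub_right_comm]
  have hV : divVariance ρ σ = ∑ k, overlapWeight p T k *
      (Real.logb 2 (p k.1) - D - Real.logb 2 (m k.2)) ^ 2 := by
    rw [divVariance, ← hD, hρ.2, Complex.one_re, div_one, one_mul, hshift]
    nth_rw 1 [hU.eq]
    rw [trace_mul_sub_sq_re hU.left hU.right hW.left hW.right, Fintype.sum_prod_type]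
    rfl
  -- Variance equals second moment minus squared mean.
  have hexp : divVariance ρ σ = ∑ k, overlapWeight p T k *
      (Real.logb 2 (p k.1) - Real.logb 2 (m k.2)) ^ 2 - D ^ 2 := by
    calc divVariance ρ σ = ∑ k, (overlapWeight p T k *
          (Real.logb 2 (p k.1) - Real.logb 2 (m k.2)) ^ 2 -
          2 * D * (overlapWeight p T k * (Real.logb 2 (p k.1) - Real.logb 2 (m k.2))) +
          D ^ 2 * overlapWeight p T k) := by
          rw [hV]; exact Finset.sum_congr rfl fun k _ => by ring
      _ = _ := by
          rw [Finset.sum_add_distrib, Finset.sum_sub_distrib, ← Finset.mul_sum, ← Finset.mul_sum,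
            ← hD', hsum]
          ring
  rw [hexp]
  linarith [sq_nonneg D]

theorem conj_apply_self (hU : Diagonalizes ρ U p) (W : Matrix n n ℂ) (j : n) :
    ((Wᴴ * ρ * W) j j).re = ∑ i, overlapWeight p (Uᴴ * W) (i, j) := by
  have : Wᴴ * ρ * W = (Uᴴ * W)ᴴ * (rdiag p * (Uᴴ * W)) := by
    rw [hU.eq, conjTranspose_mul, conjTranspose_conjTranspose]
    simp only [mul_assoc]
  rw [this, mul_apply, Complex.re_sum]
  refine Finset.sum_congr rfl fun i _ => ?_
  rw [rdiag, diagonal_mul, conjTranspose_apply, RCLike.star_def, mul_left_comm,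
    mul_comm ((starRingEnd ℂ) _), Complex.mul_conj, ← Complex.ofReal_mul, Complex.ofReal_re]
  rfl

/-- A sufficient criterion for `supp ρ ⊆ supp σ`: no weight on the kernel of `σ`. -/
theorem suppLE_of_weight (hU : Diagonalizes ρ U p) (hW : Diagonalizes σ W m)
    (h : ∀ i j, overlapWeight p (Uᴴ * W) (i, j) ≠ 0 → m j ≠ 0) : SuppLE ρ σ := by
  -- The pseudo-inverse of `σ` loses nothing: wherever `m j = 0`, the hypothesis kills the
  -- corresponding row.
  have hzero : rdiag m * (rdiag (fun j => (m j)⁻¹) * (Wᴴ * U * rdiag p)) = Wᴴ * U * rdiag p := by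
    ext j i
    rw [rdiag, rdiag, rdiag, diagonal_mul, diagonal_mul, mul_diagonal]
    by_cases hm : m j = 0
    · have h0 : overlapWeight p (Uᴴ * W) (i, j) = 0 := by
        by_contra h0; exact h i j h0 hm
      have hT : (Wᴴ * U) j i = star ((Uᴴ * W) i j) := by
        rw [← conjTranspose_apply, conjTranspose_mul, conjTranspose_conjTranspose]
      rcases mul_eq_zero.1 h0 with h1 | h1
      · simp only at h1
        simp [h1]
      · rw [Complex.normSq_eq_zero] at h1
        rw [hT, h1]
        simp
    · have : (m j : ℂ) ≠ 0 := by exact_mod_cast hm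
      rw [Complex.ofReal_inv, mul_inv_cancel_left₀ this]
  have hfac : ρ = σ * (W * (rdiag (fun j => (m j)⁻¹) * (Wᴴ * U * rdiag p)) * Uᴴ) := by
    calc ρ = (W * Wᴴ) * ρ := by rw [hW.right, one_mul]
      _ = W * (Wᴴ * U * rdiag p) * Uᴴ := by rw [hU.eq]; simp only [mul_assoc]
      _ = W * (rdiag m * (Wᴴ * W) * (rdiag (fun j => (m j)⁻¹) * (Wᴴ * U * rdiag p))) * Uᴴ := by
          rw [hW.left, mul_one, hzero]
      _ = _ := by rw [hW.eq]; simp only [mul_assoc]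
  rw [SuppLE]
  nth_rw 1 [hfac]
  rw [mulVecLin_mul]
  exact LinearMap.range_comp_le_range _ _

/-- If `ρ ≤ K σ` then `tr (ρ² σ⁻¹) ≤ K tr ρ`. -/
theorem sum_overlapWeight_mul_div_le {K : ℝ} (hK : 0 ≤ K) (hp : ∀ i, 0 ≤ p i)
    (hm : ∀ j, 0 ≤ m j)
    (hU : Diagonalizes ρ U p) (hW : Diagonalizes σ W m) (h : ((K : ℂ) • σ - ρ).PosSemidef) :
    ∑ k, overlapWeight p (Uᴴ * W) k * (p k.1 / m k.2) ≤ K * ∑ i, p i := by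
  set T := Uᴴ * W with hT
  have hquad : ∀ x : n → ℂ, ∑ i, p i * Complex.normSq ((T *ᵥ x) i) ≤
      K * ∑ j, m j * Complex.normSq (x j) := fun x => by
    have h1 := (h.conjTranspose_mul_mul_same W).dotProduct_mulVec_nonneg x
    have hρW : Wᴴ * ρ * W = Tᴴ * (rdiag p * T) := by
      rw [hU.eq, hT, conjTranspose_mul, conjTranspose_conjTranspose]
      simp only [mul_assoc]
    rw [mul_sub, sub_mul, mul_smul_comm, smul_mul_assoc, hW.conj_eq, hρW, sub_mulVec,
      dotProduct_sub, smul_mulVec, dotProduct_smul, ← mulVec_mulVec, dotProduct_mulVec _ Tᴴ,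
      ← star_mulVec, ← mulVec_mulVec x (rdiag p) T] at h1
    have hq : ∀ (d : n → ℝ) (y : n → ℂ), star y ⬝ᵥ (rdiag d *ᵥ y) =
        ((∑ i, d i * Complex.normSq (y i) : ℝ) : ℂ) := fun d y => by
      rw [dotProduct, Complex.ofReal_sum]
      refine Finset.sum_congr rfl fun i _ => ?_
      rw [rdiag, mulVec_diagonal, Pi.star_apply, RCLike.star_def, Complex.ofReal_mul,
        ← Complex.mul_conj]
      ring
    rw [hq, hq, smul_eq_mul, ← Complex.ofReal_mul, ← Complex.ofReal_sub] at h1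
    have := Complex.zero_le_real.1 h1
    linarith
  have hrow : ∀ i, p i * ∑ j, Complex.normSq (T i j) / m j ≤ K := fun i => by
    set S := ∑ j, Complex.normSq (T i j) / m j with hS
    have hS0 : 0 ≤ S := Finset.sum_nonneg fun j _ => div_nonneg (Complex.normSq_nonneg _) (hm j)
    -- The `W`-coordinates of `σ⁻¹ u i`, with `0⁻¹ = 0` off the support. Both `(T x) i` and `∑ j, m
    -- j |x j|²` equal `S`, so `hquad` yields `p i * S² ≤ K * S`.
    set x : n → ℂ := fun j => star (T i j) * ((m j)⁻¹ : ℝ) with hx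
    have hTx : (T *ᵥ x) i = (S : ℂ) := by
      rw [mulVec, dotProduct, hS, Complex.ofReal_sum]
      refine Finset.sum_congr rfl fun j _ => ?_
      rw [hx, ← mul_assoc, RCLike.star_def, Complex.mul_conj, ← Complex.ofReal_mul,
        div_eq_mul_inv]
    have hxm : ∑ j, m j * Complex.normSq (x j) = S := by
      refine Finset.sum_congr rfl fun j _ => ?_
      rw [hx, Complex.normSq_mul, RCLike.star_def, Complex.normSq_conj, Complex.normSq_ofReal]
      rcases eq_or_ne (m j) 0 with h0 | h0
      · simp [h0]
      · field_simp
    have h2 := hquad x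
    rw [hxm] at h2
    have h3 : p i * Complex.normSq ((T *ᵥ x) i) ≤ K * S :=
      (Finset.single_le_sum (f := fun i => p i * Complex.normSq ((T *ᵥ x) i))
        (fun i _ => mul_nonneg (hp i) (Complex.normSq_nonneg _)) (Finset.mem_univ i)).trans h2
    rw [hTx, Complex.normSq_ofReal, ← mul_assoc] at h3
    rcases hS0.eq_or_lt with h0 | h0
    · rw [← h0, mul_zero]; exact hK
    · exact le_of_mul_le_mul_right h3 h0
  rw [Fintype.sum_prod_type, Finset.mul_sum]
  refine Finset.sum_le_sum fun i _ => ?_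
  calc ∑ j, overlapWeight p T (i, j) * (p i / m j)
      = p i * ∑ j, Complex.normSq (T i j) / m j * p i := by
        rw [Finset.mul_sum]
        exact Finset.sum_congr rfl fun j _ => by simp only [overlapWeight]; ring
    _ = (p i * ∑ j, Complex.normSq (T i j) / m j) * p i := by rw [← Finset.sum_mul, mul_assoc]
    _ ≤ K * p i := mul_le_mul_of_nonneg_right (hrow i) (hp i)

/-- The reciprocal likelihood ratio has expectation at most `tr σ`. -/
theorem sum_overlapWeight_mul_inv_div_le {T : Matrix n n ℂ} (hT : Tᴴ * T = 1)
    (hm : ∀ j, 0 ≤ m j) :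
    ∑ k, overlapWeight p T k * (p k.1 / m k.2)⁻¹ ≤ ∑ j, m j := by
  rw [Fintype.sum_prod_type_right]
  refine Finset.sum_le_sum fun j _ => ?_
  calc ∑ i, overlapWeight p T (i, j) * (p i / m j)⁻¹
      ≤ ∑ i, Complex.normSq (T i j) * m j := Finset.sum_le_sum fun i _ => by
        -- Equality fails only where `p i = 0`: the term on the left is then zero.
        rcases eq_or_ne (p i) 0 with h0 | h0
        · simp only [overlapWeight, h0, zero_mul]
          exact mul_nonneg (Complex.normSq_nonneg _) (hm j)
        · simp only [overlapWeight, inv_div]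
          apply le_of_eq
          field_simp
    _ = m j := by rw [← Finset.sum_mul, sum_normSq_col hT, one_mul]

end Variance

/-! ### Variance bounds from `ρ_AB ≤ K • id ⊗ ρ_B`. -/

section Bounds

variable {α β : Type*} [Fintype α] [DecidableEq α] [Fintype β] [DecidableEq β]

/-- Eigenbases of `ρ_AB`, `ρ_A` and `ρ_B` with their eigenvalues. -/
structure Eigenbases (ρ : Matrix (α × β) (α × β) ℂ) (U : Matrix (α × β) (α × β) ℂ)
    (WA : Matrix α α ℂ) (WB : Matrix β β ℂ) (p : α × β → ℝ) (a : α → ℝ) (b : β → ℝ) : Prop where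
  diag : Diagonalizes ρ U p
  diagA : Diagonalizes (marginalA ρ) WA a
  diagB : Diagonalizes (marginalB ρ) WB b
  nonneg : ∀ i, 0 ≤ p i
  nonnegA : ∀ x, 0 ≤ a x
  nonnegB : ∀ y, 0 ≤ b y
  sum_eq : ∑ i, p i = 1
  sum_eqA : ∑ x, a x = 1
  sum_eqB : ∑ y, b y = 1

theorem exists_eigenbases {ρ : Matrix (α × β) (α × β) ℂ} (hρ : IsDensityOperator ρ) :
    ∃ U WA WB p a b, Eigenbases ρ U WA WB p a b := by
  obtain ⟨U, p, hU, hp⟩ := exists_diagonalizes hρ.1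
  obtain ⟨WA, a, hA, ha⟩ := exists_diagonalizes (posSemidef_marginalA hρ.1)
  obtain ⟨WB, b, hB, hb⟩ := exists_diagonalizes (posSemidef_marginalB hρ.1)
  refine ⟨U, WA, WB, p, a, b, hU, hA, hB, hp, ha, hb, ?_, ?_, ?_⟩
  · rw [← hU.trace_re, hρ.2, Complex.one_re]
  · rw [← hA.trace_re, trace_marginalA, hρ.2, Complex.one_re]
  · rw [← hB.trace_re, trace_marginalB, hρ.2, Complex.one_re]

namespace Eigenbases

variable {ρ : Matrix (α × β) (α × β) ℂ} {U : Matrix (α × β) (α × β) ℂ}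
    {WA : Matrix α α ℂ} {WB : Matrix β β ℂ} {p : α × β → ℝ} {a : α → ℝ} {b : β → ℝ}

theorem diag_cond (h : Eigenbases ρ U WA WB p a b) :
    Diagonalizes ((1 : Matrix α α ℂ) ⊗ₖ marginalB ρ) (WA ⊗ₖ WB) (fun j => b j.2) := by
  simpa using h.diagA.one_of_unitary.kronecker h.diagB

theorem diag_mutual (h : Eigenbases ρ U WA WB p a b) :
    Diagonalizes (marginalA ρ ⊗ₖ marginalB ρ) (WA ⊗ₖ WB) (fun j => a j.1 * b j.2) :=
  h.diagA.kronecker h.diagB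

/-- The sum over `i` is a diagonal entry of `ρ` in the product basis; summing over `y` is the
partial trace. -/
theorem sum_weightA (h : Eigenbases ρ U WA WB p a b) (x : α) :
    ∑ y, ∑ i, overlapWeight p (Uᴴ * (WA ⊗ₖ WB)) (i, (x, y)) = a x := by
  have h1 : (marginalA ((WA ⊗ₖ WB)ᴴ * ρ * (WA ⊗ₖ WB)) x x).re = a x := by
    rw [marginalA_conj _ h.diagB.right, h.diagA.conj_eq]
    simp [rdiag]
  simp only [← conj_apply_self h.diag]
  rw [← h1, marginalA, of_apply, Complex.re_sum]

theorem sum_weightB (h : Eigenbases ρ U WA WB p a b) (y : β) :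
    ∑ x, ∑ i, overlapWeight p (Uᴴ * (WA ⊗ₖ WB)) (i, (x, y)) = b y := by
  have h1 : (marginalB ((WA ⊗ₖ WB)ᴴ * ρ * (WA ⊗ₖ WB)) y y).re = b y := by
    rw [marginalB_conj h.diagA.right, h.diagB.conj_eq]
    simp [rdiag]
  simp only [← conj_apply_self h.diag]
  rw [← h1, marginalB, of_apply, Complex.re_sum]

theorem weight_nonneg (h : Eigenbases ρ U WA WB p a b) (k : (α × β) × (α × β)) :
    0 ≤ overlapWeight p (Uᴴ * (WA ⊗ₖ WB)) k := overlapWeight_nonneg h.nonneg _ _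

theorem pos_of_weight (h : Eigenbases ρ U WA WB p a b) {k : (α × β) × (α × β)}
    (hk : overlapWeight p (Uᴴ * (WA ⊗ₖ WB)) k ≠ 0) : 0 < p k.1 :=
  (h.nonneg _).lt_of_ne' (left_ne_zero_of_mul hk)

theorem posA_of_weight (h : Eigenbases ρ U WA WB p a b) {k : (α × β) × (α × β)}
    (hk : overlapWeight p (Uᴴ * (WA ⊗ₖ WB)) k ≠ 0) : 0 < a k.2.1 := by
  rw [← h.sum_weightA]
  have h0 := fun k => h.weight_nonneg k
  refine ((h0 k).lt_of_ne' hk).trans_le ?_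
  refine le_trans ?_ (Finset.single_le_sum (f := fun y => ∑ i, overlapWeight p _ (i, (k.2.1, y)))
    (fun y _ => Finset.sum_nonneg fun i _ => h0 _) (Finset.mem_univ k.2.2))
  exact Finset.single_le_sum (f := fun i => overlapWeight p _ (i, (k.2.1, k.2.2)))
    (fun i _ => h0 _) (Finset.mem_univ k.1)

theorem posB_of_weight (h : Eigenbases ρ U WA WB p a b) {k : (α × β) × (α × β)}
    (hk : overlapWeight p (Uᴴ * (WA ⊗ₖ WB)) k ≠ 0) : 0 < b k.2.2 := by
  rw [← h.sum_weightB]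
  have h0 := fun k => h.weight_nonneg k
  refine ((h0 k).lt_of_ne' hk).trans_le ?_
  refine le_trans ?_ (Finset.single_le_sum (f := fun x => ∑ i, overlapWeight p _ (i, (x, k.2.2)))
    (fun x _ => Finset.sum_nonneg fun i _ => h0 _) (Finset.mem_univ k.2.1))
  exact Finset.single_le_sum (f := fun i => overlapWeight p _ (i, (k.2.1, k.2.2)))
    (fun i _ => h0 _) (Finset.mem_univ k.1)

theorem sum_weight (h : Eigenbases ρ U WA WB p a b) :
    ∑ k, overlapWeight p (Uᴴ * (WA ⊗ₖ WB)) k = 1 := by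
  rw [sum_overlapWeight (overlap_mul_conjTranspose h.diag.left h.diag_cond.right), h.sum_eq]

theorem sum_weight_div_le (h : Eigenbases ρ U WA WB p a b) :
    ∑ k, overlapWeight p (Uᴴ * (WA ⊗ₖ WB)) k / a k.2.1 ≤ Fintype.card α := by
  rw [Fintype.sum_prod_type_right, Fintype.sum_prod_type]
  calc _ = ∑ x, a x / a x := by
        refine Finset.sum_congr rfl fun x _ => ?_
        have := congrArg (· / a x) (h.sum_weightA x)
        simpa only [Finset.sum_div] using this
    _ ≤ ∑ x : α, (1 : ℝ) := Finset.sum_le_sum fun x _ => div_self_le_one _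
    _ = _ := by simp

end Eigenbases

theorem suppLE_one_kronecker_marginalB {ρ : Matrix (α × β) (α × β) ℂ} (hρ : IsDensityOperator ρ) :
    SuppLE ρ ((1 : Matrix α α ℂ) ⊗ₖ marginalB ρ) := by
  obtain ⟨U, WA, WB, p, a, b, h⟩ := exists_eigenbases hρ
  exact suppLE_of_weight h.diag h.diag_cond fun i j hk => (h.posB_of_weight hk).ne'

theorem suppLE_marginalA_kronecker_marginalB {ρ : Matrix (α × β) (α × β) ℂ}
    (hρ : IsDensityOperator ρ) : SuppLE ρ (marginalA ρ ⊗ₖ marginalB ρ) := by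
  obtain ⟨U, WA, WB, p, a, b, h⟩ := exists_eigenbases hρ
  exact suppLE_of_weight h.diag h.diag_mutual fun i j hk =>
    mul_ne_zero (h.posA_of_weight hk).ne' (h.posB_of_weight hk).ne'

/-- If `ρ_AB ≤ K • id_A ⊗ ρ_B` then `V(A|B) ≤ log² (K + d_A + 1)`. -/
theorem condVariance_le {ρ : Matrix (α × β) (α × β) ℂ} (hρ : IsDensityOperator ρ) {K : ℝ}
    (hK : 0 ≤ K) (hle : ((K : ℂ) • ((1 : Matrix α α ℂ) ⊗ₖ marginalB ρ) - ρ).PosSemidef) :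
    condVariance ρ ≤ Real.logb 2 (K + Fintype.card α + 1) ^ 2 := by
  obtain ⟨U, WA, WB, p, a, b, h⟩ := exists_eigenbases hρ
  have hH : ((1 : Matrix α α ℂ) ⊗ₖ marginalB ρ).IsHermitian :=
    (PosSemidef.one.kronecker (posSemidef_marginalB hρ.1)).1
  refine (divVariance_le hρ hH h.diag h.diag_cond (suppLE_one_kronecker_marginalB hρ)).trans ?_
  have hE := sum_overlapWeight_mul_div_le hK h.nonneg (fun j => h.nonnegB j.2) h.diag h.diag_cond
    hle
  rw [h.sum_eq, mul_one] at hE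
  have hI := sum_overlapWeight_mul_inv_div_le (p := p)
    (conjTranspose_mul_overlap h.diag.right h.diag_cond.left) (fun j : α × β => h.nonnegB j.2)
  have htr : ∑ j : α × β, b j.2 = Fintype.card α := by
    rw [Fintype.sum_prod_type]
    simp [h.sum_eqB]
  rw [htr] at hI
  have := sum_mul_logb_sq_le h.weight_nonneg h.sum_weight
    (fun k hk => div_pos (h.pos_of_weight hk) (h.posB_of_weight hk)) hE hI
  refine le_trans (le_of_eq ?_) this
  refine Finset.sum_congr rfl fun k _ => ?_
  rcases eq_or_ne (overlapWeight p (Uᴴ * (WA ⊗ₖ WB)) k) 0 with h0 | h0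
  · rw [h0, zero_mul, zero_mul]
  · rw [Real.logb_div (h.pos_of_weight h0).ne' (h.posB_of_weight h0).ne']

/-- If `ρ_AB ≤ K • id_A ⊗ ρ_B` then `V(A;B) ≤ 4 log² (√(d_A K) + 2)`. -/
theorem mutualVariance_le {ρ : Matrix (α × β) (α × β) ℂ} (hρ : IsDensityOperator ρ) {K : ℝ}
    (hK : 0 ≤ K) (hle : ((K : ℂ) • ((1 : Matrix α α ℂ) ⊗ₖ marginalB ρ) - ρ).PosSemidef) :
    mutualVariance ρ ≤ 4 * Real.logb 2 (√(Fintype.card α * K) + 1 + 1) ^ 2 := by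
  obtain ⟨U, WA, WB, p, a, b, h⟩ := exists_eigenbases hρ
  have hH : (marginalA ρ ⊗ₖ marginalB ρ).IsHermitian :=
    ((posSemidef_marginalA hρ.1).kronecker (posSemidef_marginalB hρ.1)).1
  refine (divVariance_le hρ hH h.diag h.diag_mutual
    (suppLE_marginalA_kronecker_marginalB hρ)).trans ?_
  -- The comparison operator here is still `id ⊗ ρ_B`: this bounds `E[p/b]`, the second
  -- Cauchy-Schwarz factor in `hE'`.
  have hE := sum_overlapWeight_mul_div_le hK h.nonneg (fun j => h.nonnegB j.2) h.diag h.diag_cond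
    hle
  rw [h.sum_eq, mul_one] at hE
  have hI := sum_overlapWeight_mul_inv_div_le (p := p)
    (conjTranspose_mul_overlap h.diag.right h.diag_mutual.left)
    (fun j : α × β => mul_nonneg (h.nonnegA j.1) (h.nonnegB j.2))
  have htr : ∑ j : α × β, a j.1 * b j.2 = 1 := by
    rw [Fintype.sum_prod_type, ← Finset.sum_mul_sum, h.sum_eqA, h.sum_eqB, one_mul]
  rw [htr] at hI
  set w := overlapWeight p (Uᴴ * (WA ⊗ₖ WB)) with hw
  set r : (α × β) × (α × β) → ℝ := fun k => p k.1 / (a k.2.1 * b k.2.2) with hr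
  have hr0 : ∀ k, 0 ≤ r k := fun k =>
    div_nonneg (h.nonneg _) (mul_nonneg (h.nonnegA _) (h.nonnegB _))
  have hrpos : ∀ k, w k ≠ 0 → 0 < r k := fun k hk =>
    div_pos (h.pos_of_weight hk) (mul_pos (h.posA_of_weight hk) (h.posB_of_weight hk))
  have hE' : ∑ k, w k * √(r k) ≤ √(Fintype.card α * K) := by
    calc ∑ k, w k * √(r k)
        = ∑ k, √(w k / a k.2.1) * √(w k * (p k.1 / b k.2.2)) := by
          refine Finset.sum_congr rfl fun k _ => ?_
          rw [← Real.sqrt_mul (div_nonneg (h.weight_nonneg k) (h.nonnegA _))]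
          have : w k / a k.2.1 * (w k * (p k.1 / b k.2.2)) = w k ^ 2 * r k := by
            simp only [hr, div_eq_mul_inv, mul_inv]; ring
          rw [this, Real.sqrt_mul (sq_nonneg _), Real.sqrt_sq (h.weight_nonneg k)]
      _ ≤ √(∑ k, w k / a k.2.1) * √(∑ k, w k * (p k.1 / b k.2.2)) :=
          Real.sum_sqrt_mul_sqrt_le _
            (fun k => div_nonneg (h.weight_nonneg k) (h.nonnegA _))
            (fun k => mul_nonneg (h.weight_nonneg k) (div_nonneg (h.nonneg _) (h.nonnegB _)))
      _ ≤ √(Fintype.card α) * √K := mul_le_mul (Real.sqrt_le_sqrt h.sum_weight_div_le)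
          (Real.sqrt_le_sqrt hE) (Real.sqrt_nonneg _) (Real.sqrt_nonneg _)
      _ = _ := (Real.sqrt_mul (Nat.cast_nonneg _) _).symm
  have hI' : ∑ k, w k * (√(r k))⁻¹ ≤ 1 := by
    calc ∑ k, w k * (√(r k))⁻¹ ≤ ∑ k, (w k + w k * (r k)⁻¹) / 2 := by
          refine Finset.sum_le_sum fun k _ => ?_
          have h1 : (√(r k))⁻¹ ^ 2 = (r k)⁻¹ := by rw [inv_pow, Real.sq_sqrt (hr0 k)]
          -- AM-GM for 1 and `(r k)⁻¹`.
          have h2 : (√(r k))⁻¹ ≤ (1 + (r k)⁻¹) / 2 := by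
            rw [← h1]; linarith [sq_nonneg ((√(r k))⁻¹ - 1)]
          calc w k * (√(r k))⁻¹ ≤ w k * ((1 + (r k)⁻¹) / 2) :=
                mul_le_mul_of_nonneg_left h2 (h.weight_nonneg k)
            _ = _ := by ring
      _ = (∑ k, w k + ∑ k, w k * (r k)⁻¹) / 2 := by
          rw [← Finset.sum_div, Finset.sum_add_distrib]
      _ ≤ 1 := by
          have hs : ∑ k, w k = 1 := h.sum_weight
          have hi : ∑ k, w k * (r k)⁻¹ ≤ 1 := hI
          linarith
  have := sum_mul_logb_sq_le h.weight_nonneg h.sum_weight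
    (fun k hk => Real.sqrt_pos.2 (hrpos k hk)) hE' hI'
  refine le_trans (le_of_eq ?_) (mul_le_mul_of_nonneg_left this zero_le_four)
  rw [Finset.mul_sum]
  refine Finset.sum_congr rfl fun k _ => ?_
  rcases eq_or_ne (w k) 0 with h0 | h0
  · rw [← hw, h0, zero_mul, zero_mul, mul_zero]
  · rw [← hw, ← Real.logb_div (h.pos_of_weight h0).ne'
      (mul_pos (h.posA_of_weight h0) (h.posB_of_weight h0)).ne', Real.logb, Real.logb,
      Real.log_sqrt (hr0 k)]
    ring

end Bounds

theorem logb_sq_le_logb_sq {x y : ℝ} (hx : 1 ≤ x) (hxy : x ≤ y) :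
    Real.logb 2 x ^ 2 ≤ Real.logb 2 y ^ 2 :=
  pow_le_pow_left₀ (Real.logb_nonneg one_lt_two hx)
    (Real.logb_le_logb_of_le one_lt_two (zero_lt_one.trans_le hx) hxy) 2

end QInfo

theorem mainTheorem6 {α β : Type*} [Fintype α] [DecidableEq α] [Fintype β] [DecidableEq β]
    (ρ : Matrix (α × β) (α × β) ℂ) (hρ : QInfo.IsDensityOperator ρ) :
    (QInfo.relEntropy ρ ((1 : Matrix α α ℂ) ⊗ₖ QInfo.marginalB ρ) ≠ ⊤ ∧
      QInfo.relEntropy ρ (QInfo.marginalA ρ ⊗ₖ QInfo.marginalB ρ) ≠ ⊤) ∧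
    QInfo.condVariance ρ ≤ (Real.logb 2 (2 * (Fintype.card α : ℝ) ^ 2 + 1)) ^ 2 ∧
    QInfo.mutualVariance ρ ≤ 4 * (Real.logb 2 (2 * (Fintype.card α : ℝ) + 1)) ^ 2 ∧
    (QInfo.IsClassicalOnA ρ →
      QInfo.condVariance ρ ≤ (Real.logb 2 (2 * (Fintype.card α : ℝ) + 1)) ^ 2 ∧
      QInfo.mutualVariance ρ ≤ 4 * (Real.logb 2 (2 * Real.sqrt (Fintype.card α : ℝ) + 1)) ^ 2) := by
  -- On an empty index type the trace would be 0 rather than 1.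
  have hne : Nonempty α := by
    by_contra hempty
    rw [not_nonempty_iff] at hempty
    have := hρ.2
    simp [Matrix.trace] at this
  have hd : (1 : ℝ) ≤ Fintype.card α := by exact_mod_cast Fintype.card_pos
  set d : ℝ := (Fintype.card α : ℝ)
  have hgen := QInfo.posSemidef_card_smul_one_kronecker_sub hρ.1
  refine ⟨⟨?_, ?_⟩, ?_, ?_, fun hcl => ?_⟩
  · rw [QInfo.relEntropy, if_pos (QInfo.suppLE_one_kronecker_marginalB hρ)]
    exact EReal.coe_ne_top _
  · rw [QInfo.relEntropy, if_pos (QInfo.suppLE_marginalA_kronecker_marginalB hρ)]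
    exact EReal.coe_ne_top _
  -- With `K = d` the bound is `2d + 1 ≤ 2d² + 1`.
  · exact (QInfo.condVariance_le hρ (by linarith) hgen).trans
      (QInfo.logb_sq_le_logb_sq (by linarith) (by nlinarith))
  · refine (QInfo.mutualVariance_le hρ (by linarith) hgen).trans
      (mul_le_mul_of_nonneg_left (QInfo.logb_sq_le_logb_sq ?_ ?_) zero_le_four)
    · linarith [Real.sqrt_nonneg (d * d)]
    · rw [Real.sqrt_mul_self (by linarith)]
      linarith
  -- With `K = 1` the arguments are `d + 2 ≤ 2d + 1` and `√d + 2 ≤ 2√d + 1`.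
  · have hle : (((1 : ℝ) : ℂ) • ((1 : Matrix α α ℂ) ⊗ₖ QInfo.marginalB ρ) - ρ).PosSemidef := by
      rw [Complex.ofReal_one, one_smul]
      exact hcl.posSemidef_one_kronecker_sub
    refine ⟨(QInfo.condVariance_le hρ zero_le_one hle).trans
      (QInfo.logb_sq_le_logb_sq (by linarith) (by linarith)),
      (QInfo.mutualVariance_le hρ zero_le_one hle).trans
      (mul_le_mul_of_nonneg_left (QInfo.logb_sq_le_logb_sq ?_ ?_) zero_le_four)⟩
    · linarith [Real.sqrt_nonneg (d * 1)]
    · rw [mul_one]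
      linarith [Real.one_le_sqrt.2 hd]
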